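/- Let $n\ge 0$ and let $\Omega\subset\mathbb{C}^n$ be a Reinhardt domain, i.e. a nonempty connected open set such that $(t_1z_1,\dots,t_nz_n)\in\Omega$ whenever $z\in\Omega$ and $t\in (S^1)^n$. Let $F:\Omega\to\mathbb{R}$ be upper semicontinuous, bounded from below, and torically uniformly continuous, i.e. the family of functions $$F_z:(S^1)^n\to\mathbb{R},\qquad F_z(t_1,\dots,t_n)=F(t_1z_1,\dots,t_nz_n)\qquad(z\in\Omega),$$ is equicontinuous. Let $$P(F)(z)=\sup\{u(z) : u \text{ plurisubharmonic on } \Omega,\ u^*\le F \text{ on }\Omega\},\qquad z\in\Omega,$$ be the Perron–Bremermann envelope of $F$, where plurisubharmonic functions take values in $[-\infty,\infty)$ and $u^*(z)=\limsup_{\Omega\ni w\to z}u(w)$ denotes the upper semicontinuous regularization. Then $P(F)$ is real-valued and continuous on $\Omega$. -/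

import Mathlib

open Set Filter Topology MeasureTheory

namespace PerronBremermann

/-- Mean value of an extended real function over the circle of centre `c` and radius `r`, as
the mean of the positive part minus the mean of the negative part. For a function that is upper
semicontinuous and `< ⊤` on the circle the first mean is finite, so `⊤ - ⊤` does not occur. -/
noncomputable def circleMean (f : ℂ → EReal) (c : ℂ) (r : ℝ) : EReal :=
  ((⨍⁻ θ, (f (circleMap c r θ)).toENNReal ∂(volume.restrict (Ioc (0 : ℝ) (2 * Real.pi))) :
      ENNReal) : EReal) -
    ((⨍⁻ θ, (-f (circleMap c r θ)).toENNReal ∂(volume.restrict (Ioc (0 : ℝ) (2 * Real.pi))) :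
      ENNReal) : EReal)

/-- Subharmonic functions on a subset (in practice open) of the plane, with values in `[-∞, ∞)`;
the function that is identically `-∞` is allowed. -/
structure IsSubharmonicOn (f : ℂ → EReal) (U : Set ℂ) : Prop where
  usc : UpperSemicontinuousOn f U
  ne_top : ∀ c ∈ U, f c ≠ ⊤
  le_circleMean : ∀ c : ℂ, ∀ r : ℝ, 0 < r → Metric.closedBall c r ⊆ U → f c ≤ circleMean f c r

/-- Plurisubharmonic functions on an open set `Ω` of `ℂⁿ`, with values in `[-∞, ∞)`: upper
semicontinuous, and subharmonic along every complex line. Only the values on `Ω` matter. -/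
structure IsPlurisubharmonicOn {n : ℕ} (u : (Fin n → ℂ) → EReal) (Ω : Set (Fin n → ℂ)) :
    Prop where
  usc : UpperSemicontinuousOn u Ω
  ne_top : ∀ z ∈ Ω, u z ≠ ⊤
  subharmonic_line : ∀ a b : Fin n → ℂ,
    IsSubharmonicOn (fun ζ : ℂ => u (a + ζ • b)) {ζ : ℂ | a + ζ • b ∈ Ω}

/-- Upper semicontinuous regularization `u*(z) = limsup_{Ω ∋ w → z} u(w)` (the point `z` itself
is included when it lies in `Ω`). -/
noncomputable def uscReg {n : ℕ} (Ω : Set (Fin n → ℂ)) (u : (Fin n → ℂ) → EReal)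
    (z : Fin n → ℂ) : EReal :=
  limsup u (𝓝[Ω] z)

/-- The Perron–Bremermann envelope
`P(F)(z) = sup {u(z) | u plurisubharmonic on Ω, u* ≤ F on Ω}` of a real function on `Ω`. -/
noncomputable def envelope {n : ℕ} (Ω : Set (Fin n → ℂ)) (F : (Fin n → ℂ) → ℝ)
    (z : Fin n → ℂ) : EReal :=
  sSup {x : EReal | ∃ u : (Fin n → ℂ) → EReal, IsPlurisubharmonicOn u Ω ∧
    (∀ w ∈ Ω, uscReg Ω u w ≤ (F w : EReal)) ∧ x = u z}

/-- The action of the torus `(S¹)ⁿ` on `ℂⁿ`. -/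
def rotate {n : ℕ} (t : Fin n → Circle) (z : Fin n → ℂ) : Fin n → ℂ :=
  fun j => (t j : ℂ) * z j

/-- A Reinhardt domain: a nonempty connected open set that is invariant under the torus. -/
structure IsReinhardtDomain {n : ℕ} (Ω : Set (Fin n → ℂ)) : Prop where
  isOpen : IsOpen Ω
  isConnected : IsConnected Ω
  rotate_mem : ∀ t : Fin n → Circle, ∀ z ∈ Ω, rotate t z ∈ Ω

/-- Torically uniformly continuous functions on `A`: the family of the functions
`t ↦ F (t z)` on the torus, indexed by `z ∈ A`, is equicontinuous. -/
def ToricallyUniformlyContinuousOn {n : ℕ} (F : (Fin n → ℂ) → ℝ) (A : Set (Fin n → ℂ)) : Prop :=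
  Equicontinuous (fun (z : A) (t : Fin n → Circle) => F (rotate t (z : Fin n → ℂ)))

end PerronBremermann

/-! The usc regularization `V` of the envelope `E` is again a competitor: `V ≤ F` because `F` is
usc, and `V` is plurisubharmonic by the reverse Fatou lemma (`IsRealPsh.of_frequently`). Hence `E =
V` on `Ω` is usc; the constant competitor `m`, a lower bound of `F`, makes it real-valued. Rotating
a competitor and subtracting `ε` gives a competitor when the rotation is small, so `E` inherits the
toric modulus of `F` (`rotate_le_add`).

Lower semicontinuity at `z₀` follows from this modulus and subharmonicity. Nonzero coordinates are
moved one at a time: in the coordinate `σ = log (z / w)` rotations are vertical translations, so a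
slice is at most `f w + e` on the imaginary axis, and an explicit harmonic majorant on a rectangle
carries this bound across to the centre (`le_of_logBox`). The vanishing coordinates are moved
together, along a disc whose boundary consists of rotations of `w`: if `v w` were far below `v z₀`,
so would be `v` on a fixed arc, and the mean value inequality would fail. -/

namespace PerronBremermann

/-! ### Circle means, circle averages and a reverse Fatou lemma. -/

/-- The normalized Lebesgue measure on `(0, 2π]`. -/
noncomputable def angleMeasure : Measure ℝ :=
  ((volume.restrict (Ioc (0 : ℝ) (2 * Real.pi))) univ)⁻¹ •
    volume.restrict (Ioc (0 : ℝ) (2 * Real.pi))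

theorem angleMeasure_eq :
    angleMeasure = ENNReal.ofReal (2 * Real.pi)⁻¹ •
      volume.restrict (Ioc (0 : ℝ) (2 * Real.pi)) := by
  rw [angleMeasure, Measure.restrict_apply_univ, Real.volume_Ioc, sub_zero,
    ENNReal.ofReal_inv_of_pos Real.two_pi_pos]

instance : IsProbabilityMeasure angleMeasure := by
  constructor
  rw [angleMeasure_eq, Measure.smul_apply, Measure.restrict_apply_univ, Real.volume_Ioc, sub_zero,
    smul_eq_mul, ← ENNReal.ofReal_mul (by positivity),
    inv_mul_cancel₀ Real.two_pi_pos.ne', ENNReal.ofReal_one]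

theorem circleAverage_eq_integral (f : ℂ → ℝ) (c : ℂ) (r : ℝ) :
    Real.circleAverage f c r = ∫ θ, f (circleMap c r θ) ∂angleMeasure := by
  rw [Real.circleAverage_def, angleMeasure_eq, integral_smul_measure,
    intervalIntegral.integral_of_le Real.two_pi_pos.le, ENNReal.toReal_ofReal (by positivity)]

theorem circleMean_mono {f g : ℂ → EReal} {c : ℂ} {r : ℝ}
    (h : ∀ z ∈ Metric.sphere c |r|, f z ≤ g z) : circleMean f c r ≤ circleMean g c r := by
  unfold circleMean laverage
  refine EReal.sub_le_sub ?_ ?_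
  · exact EReal.coe_ennreal_le_coe_ennreal_iff.2 (lintegral_mono fun θ =>
      EReal.toENNReal_le_toENNReal (h _ (circleMap_mem_sphere' c r θ)))
  · exact EReal.coe_ennreal_le_coe_ennreal_iff.2 (lintegral_mono fun θ =>
      EReal.toENNReal_le_toENNReal (EReal.neg_le_neg_iff.2 (h _ (circleMap_mem_sphere' c r θ))))

theorem integrable_circleMap {f : ℂ → ℝ} {c : ℂ} {r : ℝ} (hf : CircleIntegrable f c r) :
    Integrable (fun θ => f (circleMap c r θ)) angleMeasure := by
  rw [angleMeasure_eq]
  refine Integrable.smul_measure ?_ ENNReal.ofReal_ne_top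
  exact (intervalIntegrable_iff_integrableOn_Ioc_of_le Real.two_pi_pos.le).1 hf

/-- Integrability makes both the positive and the negative part finite, so the extended difference
is an honest real one. -/
theorem circleMean_coe {g : ℂ → ℝ} {c : ℂ} {r : ℝ} (hg : CircleIntegrable g c r) :
    circleMean (fun z => (g z : EReal)) c r = (Real.circleAverage g c r : ℝ) := by
  have hi := integrable_circleMap hg
  rw [circleAverage_eq_integral, integral_eq_lintegral_pos_part_sub_lintegral_neg_part hi,
    EReal.coe_sub]
  unfold circleMean laverage
  change ((∫⁻ θ, _ ∂angleMeasure : ENNReal) : EReal) - ((∫⁻ θ, _ ∂angleMeasure : ENNReal) : EReal)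
    = _
  have h1 : ∫⁻ θ, ENNReal.ofReal (g (circleMap c r θ)) ∂angleMeasure ≠ ⊤ :=
    (hi.lintegral_lt_top).ne
  have h2 : ∫⁻ θ, ENNReal.ofReal (-g (circleMap c r θ)) ∂angleMeasure ≠ ⊤ :=
    (hi.neg.lintegral_lt_top).ne
  simp only [← EReal.coe_neg, EReal.real_coe_toENNReal]
  rw [← EReal.toReal_coe_ennreal, ← EReal.toReal_coe_ennreal, EReal.coe_toReal (by simpa) (by simp),
    EReal.coe_toReal (by simpa) (by simp)]

theorem circleIntegrable_of_bounded {f : ℂ → ℝ} {c : ℂ} {r m M : ℝ}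
    (hf : UpperSemicontinuousOn f (Metric.sphere c |r|))
    (hm : ∀ z ∈ Metric.sphere c |r|, m ≤ f z) (hM : ∀ z ∈ Metric.sphere c |r|, f z ≤ M) :
    CircleIntegrable f c r := by
  have husc : UpperSemicontinuous (fun θ => f (circleMap c r θ)) := by
    rw [← upperSemicontinuousOn_univ_iff]
    exact hf.comp (continuous_circleMap c r).continuousOn
      fun θ _ => circleMap_mem_sphere' c r θ
  rw [CircleIntegrable, intervalIntegrable_iff]
  refine Measure.integrableOn_of_bounded (M := max |m| |M|) ?_
    husc.measurable.aestronglyMeasurable ?_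
  · rw [uIoc_of_le Real.two_pi_pos.le]
    exact measure_Ioc_lt_top.ne
  · refine ae_of_all _ fun θ => ?_
    have h1 := hm _ (circleMap_mem_sphere' c r θ)
    have h2 := hM _ (circleMap_mem_sphere' c r θ)
    exact abs_le_max_abs_abs h1 h2

theorem circleIntegrable_of_upperSemicontinuousOn {f : ℂ → ℝ} {c : ℂ} {r m : ℝ}
    (hf : UpperSemicontinuousOn f (Metric.sphere c |r|))
    (hm : ∀ z ∈ Metric.sphere c |r|, m ≤ f z) : CircleIntegrable f c r := by
  obtain ⟨M, hM⟩ := hf.bddAbove_of_isCompact (isCompact_sphere c |r|)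
  exact circleIntegrable_of_bounded hf hm fun z hz => hM (mem_image_of_mem f hz)

theorem ofReal_integral_sub_const {α : Type*} [MeasurableSpace α] {μ : Measure α}
    [IsProbabilityMeasure μ] {f : α → ℝ} {m : ℝ} (hf : Integrable f μ) (hm : ∀ x, m ≤ f x) :
    ENNReal.ofReal ((∫ x, f x ∂μ) - m) = ∫⁻ x, ENNReal.ofReal (f x - m) ∂μ := by
  rw [← ofReal_integral_eq_lintegral_ofReal (f := fun x => f x - m)
    (hf.sub (integrable_const m)) (ae_of_all _ fun x => sub_nonneg.2 (hm x)),
    integral_sub hf (integrable_const m)]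
  simp

/-- Reverse Fatou lemma for real functions bounded on both sides. -/
theorem le_integral_of_eventually_lt {α : Type*} [MeasurableSpace α] {μ : Measure α}
    [IsProbabilityMeasure μ] {g : ℕ → α → ℝ} {h : α → ℝ} {m M s : ℝ}
    (hg : ∀ j, Measurable (g j)) (hh : Integrable h μ)
    (hm : ∀ j x, m ≤ g j x) (hmh : ∀ x, m ≤ h x) (hM : ∀ j x, g j x ≤ M)
    (hlt : ∀ x c, h x < c → ∀ᶠ j in atTop, g j x < c)
    (hs : ∀ j, s ≤ ∫ x, g j x ∂μ) : s ≤ ∫ x, h x ∂μ := by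
  have hgi : ∀ j, Integrable (g j) μ := fun j =>
    Integrable.of_bound (hg j).aestronglyMeasurable (max |m| |M|)
      (ae_of_all _ fun x => abs_le_max_abs_abs (hm j x) (hM j x))
  -- Subtracting the common lower bound `m` makes everything nonnegative; the constant `M - m`
  -- dominates.
  have key := limsup_lintegral_le (μ := μ) (f := fun j x => ENNReal.ofReal (g j x - m))
    (fun _ => ENNReal.ofReal (M - m)) (fun j => ((hg j).sub_const m).ennreal_ofReal)
    (fun j => ae_of_all _ fun x => ENNReal.ofReal_le_ofReal (by linarith [hM j x])) (by simp)
  have h1 : ENNReal.ofReal (s - m) ≤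
      limsup (fun j => ∫⁻ x, ENNReal.ofReal (g j x - m) ∂μ) atTop := by
    refine le_limsup_of_frequently_le (Frequently.of_forall fun j => ?_)
    rw [← ofReal_integral_sub_const (hgi j) (hm j)]
    exact ENNReal.ofReal_le_ofReal (sub_le_sub_right (hs j) m)
  have h2 : ∫⁻ x, limsup (fun j => ENNReal.ofReal (g j x - m)) atTop ∂μ ≤
      ∫⁻ x, ENNReal.ofReal (h x - m) ∂μ := by
    refine lintegral_mono fun x => ?_
    refine ENNReal.le_of_forall_pos_le_add fun ε hε _ => ?_
    rw [← ENNReal.ofReal_coe_nnreal, ← ENNReal.ofReal_add (sub_nonneg.2 (hmh x)) ε.coe_nonneg]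
    refine limsup_le_of_le (h := ?_)
    filter_upwards [hlt x (h x + ε) (lt_add_of_pos_right _ hε)] with j hj
    exact ENNReal.ofReal_le_ofReal (by linarith)
  have h3 := h1.trans (key.trans h2)
  rw [← ofReal_integral_sub_const hh hmh, ENNReal.ofReal_le_ofReal_iff] at h3
  · linarith
  · have := integral_mono (integrable_const m) hh hmh
    simpa using this

/-! ### Real-valued plurisubharmonic functions. -/

/-- Real-valued plurisubharmonic functions, with the mean value inequality expressed by real
circle averages. -/
structure IsRealPsh {n : ℕ} (v : (Fin n → ℂ) → ℝ) (Ω : Set (Fin n → ℂ)) : Prop where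
  usc : UpperSemicontinuousOn v Ω
  le_circleAverage : ∀ (a b : Fin n → ℂ) (c : ℂ) (r : ℝ), 0 < r →
    (∀ ζ ∈ Metric.closedBall c r, a + ζ • b ∈ Ω) →
      v (a + c • b) ≤ Real.circleAverage (fun ζ => v (a + ζ • b)) c r

theorem upperSemicontinuousOn_line {n : ℕ} {β : Type*} [Preorder β] {v : (Fin n → ℂ) → β}
    {Ω : Set (Fin n → ℂ)} (hv : UpperSemicontinuousOn v Ω) (a b : Fin n → ℂ) {S : Set ℂ}
    (hS : ∀ ζ ∈ S, a + ζ • b ∈ Ω) : UpperSemicontinuousOn (fun ζ : ℂ => v (a + ζ • b)) S :=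
  hv.comp (Continuous.continuousOn (by fun_prop)) hS

theorem circleIntegrable_line {n : ℕ} {v : (Fin n → ℂ) → ℝ} {Ω : Set (Fin n → ℂ)} {m : ℝ}
    (hv : UpperSemicontinuousOn v Ω) (hm : ∀ z ∈ Ω, m ≤ v z) {a b : Fin n → ℂ} {c : ℂ} {r : ℝ}
    (h : ∀ ζ ∈ Metric.sphere c |r|, a + ζ • b ∈ Ω) :
    CircleIntegrable (fun ζ => v (a + ζ • b)) c r :=
  circleIntegrable_of_upperSemicontinuousOn (upperSemicontinuousOn_line hv a b h)
    fun ζ hζ => hm _ (h ζ hζ)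

theorem sphere_abs_subset {c : ℂ} {r : ℝ} (hr : 0 < r) :
    Metric.sphere c |r| ⊆ Metric.closedBall c r := by
  rw [abs_of_pos hr]
  exact Metric.sphere_subset_closedBall

theorem upperSemicontinuousOn_coe {α : Type*} [TopologicalSpace α] {v : α → ℝ} {s : Set α}
    (hv : UpperSemicontinuousOn v s) : UpperSemicontinuousOn (fun z => (v z : EReal)) s :=
  continuous_coe_real_ereal.comp_upperSemicontinuousOn hv fun _ _ h => EReal.coe_le_coe_iff.2 h

theorem IsRealPsh.isPlurisubharmonicOn {n : ℕ} {v : (Fin n → ℂ) → ℝ} {Ω : Set (Fin n → ℂ)}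
    {m : ℝ} (hv : IsRealPsh v Ω) (hm : ∀ z ∈ Ω, m ≤ v z) :
    IsPlurisubharmonicOn (fun z => (v z : EReal)) Ω where
  usc := upperSemicontinuousOn_coe hv.usc
  ne_top := fun z _ => EReal.coe_ne_top _
  subharmonic_line := fun a b =>
    { usc := upperSemicontinuousOn_line (upperSemicontinuousOn_coe hv.usc) a b fun ζ hζ => hζ
      ne_top := fun z _ => EReal.coe_ne_top _
      le_circleMean := fun c r hr h => by
        rw [circleMean_coe (g := fun ζ => v (a + ζ • b))
          (circleIntegrable_line hv.usc hm fun ζ hζ => h (sphere_abs_subset hr hζ))]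
        exact EReal.coe_le_coe_iff.2 (hv.le_circleAverage a b c r hr h) }

theorem isRealPsh_const {n : ℕ} (Ω : Set (Fin n → ℂ)) (m : ℝ) : IsRealPsh (fun _ => m) Ω where
  usc := upperSemicontinuousOn_const
  le_circleAverage := fun a b c r _ _ => by rw [Real.circleAverage_const]

/-- Rotations are complex linear, hence map complex lines to complex lines with the same parameter.
-/
theorem IsRealPsh.rotate_sub {n : ℕ} {v : (Fin n → ℂ) → ℝ} {Ω : Set (Fin n → ℂ)} {m : ℝ}
    (hv : IsRealPsh v Ω) (hm : ∀ z ∈ Ω, m ≤ v z) (t : Fin n → Circle)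
    (ht : ∀ z ∈ Ω, rotate t z ∈ Ω) (ε : ℝ) : IsRealPsh (fun z => v (rotate t z) - ε) Ω := by
  have hlin : ∀ (a b : Fin n → ℂ) (ζ : ℂ),
      rotate t (a + ζ • b) = rotate t a + ζ • rotate t b := by
    intro a b ζ
    ext j
    simp [rotate]
    ring
  have hcont : Continuous (rotate t) := by
    unfold rotate
    fun_prop
  constructor
  · have h1 : UpperSemicontinuousOn (fun z => v (rotate t z)) Ω :=
      hv.usc.comp hcont.continuousOn ht
    exact (continuous_sub_right ε).comp_upperSemicontinuousOn h1
      fun _ _ h => sub_le_sub_right h ε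
  · intro a b c r hr h
    have h' : ∀ ζ ∈ Metric.closedBall c r, rotate t a + ζ • rotate t b ∈ Ω := fun ζ hζ => by
      rw [← hlin]
      exact ht _ (h ζ hζ)
    have h1 := hv.le_circleAverage (rotate t a) (rotate t b) c r hr h'
    have hi := circleIntegrable_line (c := c) (r := r) hv.usc hm
      fun ζ hζ => h' ζ (sphere_abs_subset hr hζ)
    simp only [hlin]
    rw [circleAverage_eq_integral] at h1 ⊢
    rw [integral_sub (integrable_circleMap hi) (integrable_const ε)]
    simpa using h1

/-! ### The envelope as a plurisubharmonic function with a toric modulus. -/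

section Envelope

variable {n : ℕ} {Ω : Set (Fin n → ℂ)} {F : (Fin n → ℂ) → ℝ}

theorem le_uscReg (u : (Fin n → ℂ) → EReal) {z : Fin n → ℂ} (hz : z ∈ Ω) :
    u z ≤ uscReg Ω u z := by
  refine le_limsup_of_frequently_le' ?_
  rw [frequently_iff]
  intro s hs
  exact ⟨z, mem_of_mem_nhdsWithin hz hs, le_rfl⟩

theorem uscReg_le (hF : UpperSemicontinuousOn F Ω) {u : (Fin n → ℂ) → EReal}
    (hu : ∀ z ∈ Ω, u z ≤ F z) {z : Fin n → ℂ} (hz : z ∈ Ω) : uscReg Ω u z ≤ F z :=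
  (limsup_le_limsup (eventually_mem_nhdsWithin.mono fun w hw => hu w hw)).trans
    ((upperSemicontinuousOn_coe hF).limsup_le z hz)

theorem upperSemicontinuousOn_uscReg (u : (Fin n → ℂ) → EReal) :
    UpperSemicontinuousOn (uscReg Ω u) Ω := by
  intro z hz c hc
  obtain ⟨d, hd, hdc⟩ := exists_between hc
  have h1 : ∀ᶠ w in 𝓝[Ω] z, u w < d := eventually_lt_of_limsup_lt hd
  filter_upwards [eventually_eventually_nhdsWithin.2 h1] with w hw
  exact (limsup_le_of_le (h := hw.mono fun _ h => h.le)).trans_lt hdc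

theorem le_envelope {u : (Fin n → ℂ) → EReal} (hu : IsPlurisubharmonicOn u Ω)
    (hF : UpperSemicontinuousOn F Ω) (h : ∀ z ∈ Ω, u z ≤ F z) (z : Fin n → ℂ) :
    u z ≤ envelope Ω F z :=
  le_sSup ⟨u, hu, fun _ hw => uscReg_le hF h hw, rfl⟩

theorem envelope_le {z : Fin n → ℂ} (hz : z ∈ Ω) : envelope Ω F z ≤ F z := by
  refine sSup_le ?_
  rintro _ ⟨u, -, hu, rfl⟩
  exact (le_uscReg u hz).trans (hu z hz)

/-- The mean is taken of a majorant `g`, later the regularization, since the envelope is not yet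
known to be measurable. -/
theorem envelope_le_circleMean {g : (Fin n → ℂ) → EReal}
    (hg : ∀ z ∈ Ω, envelope Ω F z ≤ g z) (a b : Fin n → ℂ) {c : ℂ} {r : ℝ} (hr : 0 < r)
    (h : ∀ ζ ∈ Metric.closedBall c r, a + ζ • b ∈ Ω) :
    envelope Ω F (a + c • b) ≤ circleMean (fun ζ => g (a + ζ • b)) c r := by
  refine sSup_le ?_
  rintro _ ⟨u, hu, huF, rfl⟩
  refine ((hu.subharmonic_line a b).le_circleMean c r hr h).trans (circleMean_mono fun ζ hζ => ?_)
  have hζ' := h ζ (sphere_abs_subset hr hζ)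
  have hle : u (a + ζ • b) ≤ envelope Ω F (a + ζ • b) := le_sSup ⟨u, hu, huF, rfl⟩
  exact hle.trans (hg _ hζ')

/-- Values of `v` are approached by values of `E` at nearby points. Translating the disc to these
points and letting them converge, reverse Fatou and upper semicontinuity turn the bound for `E` into
the mean value inequality for `v`. -/
theorem IsRealPsh.of_frequently {E v : (Fin n → ℂ) → ℝ} {m : ℝ} (hΩ : IsOpen Ω)
    (hv : UpperSemicontinuousOn v Ω) (hm : ∀ z ∈ Ω, m ≤ v z)
    (hE : ∀ (a b : Fin n → ℂ) (c : ℂ) (r : ℝ), 0 < r →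
      (∀ ζ ∈ Metric.closedBall c r, a + ζ • b ∈ Ω) →
        E (a + c • b) ≤ Real.circleAverage (fun ζ => v (a + ζ • b)) c r)
    (hfreq : ∀ z ∈ Ω, ∀ s < v z, ∃ᶠ w in 𝓝 z, s < E w) : IsRealPsh v Ω := by
  refine ⟨hv, fun a b c r hr h => le_of_forall_lt fun s hs => ?_⟩
  obtain ⟨s', hs', hs''⟩ := exists_between hs
  refine hs'.trans_le ?_
  obtain ⟨M, hM⟩ := UpperSemicontinuousOn.bddAbove_of_isCompact
    (isCompact_closedBall c r)
    (upperSemicontinuousOn_line hv a b h)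
  have hO : IsOpen {z | z ∈ Ω ∧ v z < M + 1} := by
    rw [isOpen_iff_mem_nhds]
    rintro z ⟨hz, hzM⟩
    have := hv z hz _ hzM
    rw [hΩ.nhdsWithin_eq hz] at this
    filter_upwards [this, hΩ.mem_nhds hz] with w h1 h2 using ⟨h2, h1⟩
  have hK : IsCompact ((fun ζ : ℂ => a + ζ • b) '' Metric.closedBall c r) :=
    (isCompact_closedBall c r).image (by fun_prop)
  -- All small translates of the disc stay in `Ω`, with the common bound `M + 1` that Fatou needs.
  obtain ⟨δ, hδ, hthick⟩ := hK.exists_thickening_subset_open hO (by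
    rintro _ ⟨ζ, hζ, rfl⟩
    exact ⟨h ζ hζ, lt_of_le_of_lt (hM ⟨ζ, hζ, rfl⟩) (lt_add_one M)⟩)
  have hcΩ : a + c • b ∈ Ω := h c (Metric.mem_closedBall_self hr.le)
  obtain ⟨x, hx, hxE⟩ := exists_seq_forall_of_frequently
    ((hfreq _ hcΩ s' hs'').and_eventually (Metric.ball_mem_nhds _ hδ))
  let y : ℕ → Fin n → ℂ := fun j => x j - c • b
  have hy : Tendsto y atTop (𝓝 a) := by
    have := hx.sub_const (c • b)
    rwa [add_sub_cancel_right] at this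
  have hyΩ : ∀ j, ∀ ζ ∈ Metric.closedBall c r, y j + ζ • b ∈ Ω ∧ v (y j + ζ • b) < M + 1 := by
    intro j ζ hζ
    refine hthick (Metric.mem_thickening_iff.2 ⟨a + ζ • b, mem_image_of_mem _ hζ, ?_⟩)
    have h1 := (hxE j).2
    rw [dist_eq_norm] at h1
    rw [dist_eq_norm]
    convert h1 using 2
    simp only [y]
    abel
  have hcirc : ∀ θ, circleMap c r θ ∈ Metric.closedBall c r := fun θ =>
    circleMap_mem_closedBall c hr.le θ
  rw [circleAverage_eq_integral]
  refine le_integral_of_eventually_lt (g := fun j θ => v (y j + circleMap c r θ • b)) (m := m)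
    (M := M + 1) ?_ ?_ ?_ ?_ ?_ ?_ ?_
  · intro j
    have : UpperSemicontinuous fun θ => v (y j + circleMap c r θ • b) := by
      rw [← upperSemicontinuousOn_univ_iff]
      exact hv.comp (Continuous.continuousOn (by fun_prop)) fun θ _ => (hyΩ j _ (hcirc θ)).1
    exact this.measurable
  · exact integrable_circleMap (circleIntegrable_line hv hm
      fun ζ hζ => h ζ (sphere_abs_subset hr hζ))
  · exact fun j θ => hm _ (hyΩ j _ (hcirc θ)).1
  · exact fun θ => hm _ (h _ (hcirc θ))
  · exact fun j θ => (hyΩ j _ (hcirc θ)).2.le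
  · intro θ d hd
    have h1 := hv _ (h _ (hcirc θ)) d hd
    rw [hΩ.nhdsWithin_eq (h _ (hcirc θ))] at h1
    exact (hy.add_const _).eventually h1
  · intro j
    have h1 := hE (y j) b c r hr fun ζ hζ => (hyΩ j ζ hζ).1
    rw [circleAverage_eq_integral] at h1
    refine le_trans (hxE j).1.le ?_
    simpa [y] using h1

/-- The envelope of an upper semicontinuous function bounded from below is a real-valued
plurisubharmonic function, and it is the largest one below the given function. -/
theorem exists_isRealPsh_eq_envelope {m : ℝ} (hΩ : IsOpen Ω) (hF : UpperSemicontinuousOn F Ω)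
    (hm : ∀ z ∈ Ω, m ≤ F z) :
    ∃ v : (Fin n → ℂ) → ℝ, IsRealPsh v Ω ∧ (∀ z ∈ Ω, m ≤ v z) ∧ (∀ z ∈ Ω, v z ≤ F z) ∧
      ∀ z ∈ Ω, envelope Ω F z = v z := by
  have hmE : ∀ z, (m : EReal) ≤ envelope Ω F z := fun z =>
    le_envelope (u := fun _ => (m : EReal))
      ((isRealPsh_const Ω m).isPlurisubharmonicOn fun _ _ => le_rfl) hF
      (fun z hz => EReal.coe_le_coe_iff.2 (hm z hz)) z
  set V := uscReg Ω (envelope Ω F) with hV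
  have hEV : ∀ z ∈ Ω, envelope Ω F z ≤ V z := fun z hz => le_uscReg _ hz
  have hVF : ∀ z ∈ Ω, V z ≤ F z := fun z hz => uscReg_le hF (fun w hw => envelope_le hw) hz
  have hE : ∀ z ∈ Ω, ((envelope Ω F z).toReal : EReal) = envelope Ω F z := fun z hz =>
    EReal.coe_toReal (ne_top_of_le_ne_top (EReal.coe_ne_top _) (envelope_le hz))
      (ne_bot_of_le_ne_bot (EReal.coe_ne_bot m) (hmE z))
  have hVr : ∀ z ∈ Ω, ((V z).toReal : EReal) = V z := fun z hz =>
    EReal.coe_toReal (ne_top_of_le_ne_top (EReal.coe_ne_top _) (hVF z hz))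
      (ne_bot_of_le_ne_bot (EReal.coe_ne_bot m) ((hmE z).trans (hEV z hz)))
  have hmv : ∀ z ∈ Ω, m ≤ (V z).toReal := fun z hz => by
    rw [← EReal.coe_le_coe_iff, hVr z hz]
    exact (hmE z).trans (hEV z hz)
  have husc : UpperSemicontinuousOn (fun z => (V z).toReal) Ω := by
    intro z hz c hc
    rw [← EReal.coe_lt_coe_iff, hVr z hz] at hc
    filter_upwards [upperSemicontinuousOn_uscReg _ z hz _ hc, eventually_mem_nhdsWithin]
      with w hw hwΩ
    rw [← EReal.coe_lt_coe_iff, hVr w hwΩ]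
    exact hw
  have hpsh : IsRealPsh (fun z => (V z).toReal) Ω := by
    refine IsRealPsh.of_frequently (E := fun z => (envelope Ω F z).toReal) hΩ husc hmv ?_ ?_
    · intro a b c r hr h
      rw [← EReal.coe_le_coe_iff, hE _ (h c (Metric.mem_closedBall_self hr.le)),
        ← circleMean_coe (circleIntegrable_line husc hmv
          fun ζ hζ => h ζ (sphere_abs_subset hr hζ))]
      exact envelope_le_circleMean (g := fun z => ((V z).toReal : EReal))
        (fun z hz => (hEV z hz).trans (hVr z hz).ge) a b hr h
    · intro z hz s hs
      rw [← EReal.coe_lt_coe_iff, hVr z hz] at hs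
      have h1 : ∃ᶠ w in 𝓝[Ω] z, (s : EReal) < envelope Ω F w := frequently_lt_of_lt_limsup
        (by isBoundedDefault) hs
      rw [hΩ.nhdsWithin_eq hz] at h1
      refine (h1.and_eventually (hΩ.mem_nhds hz)).mono fun w hw => ?_
      rw [← EReal.coe_lt_coe_iff, hE w hw.2]
      exact hw.1
  refine ⟨_, hpsh, hmv, fun z hz => ?_, fun z hz => le_antisymm ?_ ?_⟩
  · rw [← EReal.coe_le_coe_iff, hVr z hz]
    exact hVF z hz
  · rw [hVr z hz]
    exact hEV z hz
  · exact le_envelope (hpsh.isPlurisubharmonicOn hmv) hF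
      (fun w hw => (hVr w hw).le.trans (hVF w hw)) z

/-- The envelope inherits the toric modulus of continuity. -/
theorem rotate_le_add {m ε : ℝ} {v : (Fin n → ℂ) → ℝ} (hF : UpperSemicontinuousOn F Ω)
    (hv : IsRealPsh v Ω) (hm : ∀ z ∈ Ω, m ≤ v z) (hvF : ∀ z ∈ Ω, v z ≤ F z)
    (hE : ∀ z ∈ Ω, envelope Ω F z = v z) {t : Fin n → Circle}
    (ht : ∀ z ∈ Ω, rotate t z ∈ Ω) (hFt : ∀ z ∈ Ω, F (rotate t z) ≤ F z + ε)
    {z : Fin n → ℂ} (hz : z ∈ Ω) : v (rotate t z) ≤ v z + ε := by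
  have h1 := le_envelope (F := F) ((hv.rotate_sub hm t ht ε).isPlurisubharmonicOn (m := m - ε)
    fun w hw => sub_le_sub_right (hm _ (ht w hw)) ε) hF (fun w hw => EReal.coe_le_coe_iff.2 (by
      linarith [hvF _ (ht w hw), hFt w hw])) z
  rw [hE z hz, EReal.coe_le_coe_iff] at h1
  linarith

/-- Toric modulus of continuity in terms of angles. -/
theorem exists_angle_rotate_le {ε : ℝ} (hε : 0 < ε) (hF : ToricallyUniformlyContinuousOn F Ω) :
    ∃ τ > 0, ∀ θ : Fin n → ℝ, (∀ j, |θ j| ≤ τ) → ∀ z ∈ Ω,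
      F (rotate (fun j => Circle.exp (θ j)) z) ≤ F z + ε := by
  -- Equicontinuity at the identity of the torus is enough.
  have h1 := Metric.equicontinuousAt_iff_right.1 (hF 1) ε hε
  have hc : Continuous fun θ : Fin n → ℝ => (fun j => Circle.exp (θ j) : Fin n → Circle) := by
    fun_prop
  have h0 : (fun j => Circle.exp ((0 : Fin n → ℝ) j) : Fin n → Circle) = 1 := by
    ext j
    simp
  have h2 := hc.tendsto 0
  rw [h0] at h2
  obtain ⟨τ, hτ, h3⟩ := Metric.eventually_nhds_iff_ball.1 (h2.eventually h1)
  refine ⟨τ / 2, half_pos hτ, fun θ hθ z hz => ?_⟩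
  have h4 := h3 θ (by
    rw [Metric.mem_ball, dist_zero_right]
    refine lt_of_le_of_lt ((pi_norm_le_iff_of_nonneg (half_pos hτ).le).2 hθ) (half_lt_self hτ))
    ⟨z, hz⟩
  have h5 : rotate (1 : Fin n → Circle) z = z := by
    ext j
    simp [rotate]
  rw [h5, Real.dist_eq, abs_lt] at h4
  linarith [h4.1]

end Envelope

/-! ### Maximum principle and logarithmic boxes in the plane. -/

theorem circleAverage_re_add_const {G : ℂ → ℂ} {p : ℂ} {r : ℝ} (hr : 0 < r)
    (hG : ∀ z ∈ Metric.closedBall p r, DifferentiableAt ℂ G z) (C : ℝ) :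
    CircleIntegrable (fun z => (G z).re + C) p r ∧
      Real.circleAverage (fun z => (G z).re + C) p r = (G p).re + C := by
  have hcont : ContinuousOn G (Metric.closedBall p r) := fun z hz =>
    (hG z hz).continuousAt.continuousWithinAt
  have hd : DiffContOnCl ℂ G (Metric.ball p |r|) := by
    rw [abs_of_pos hr]
    refine DifferentiableOn.diffContOnCl fun z hz => (hG z ?_).differentiableWithinAt
    rwa [closure_ball p hr.ne'] at hz
  have hci : CircleIntegrable G p r :=
    (hcont.mono Metric.sphere_subset_closedBall).circleIntegrable hr.le
  have hre : CircleIntegrable (fun z => (G z).re) p r :=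
    ((Complex.continuous_re.comp_continuousOn hcont).mono
      Metric.sphere_subset_closedBall).circleIntegrable hr.le
  refine ⟨hre.add (circleIntegrable_const C p r), ?_⟩
  have h1 : Real.circleAverage (fun z => (G z).re) p r = (G p).re := by
    have := Complex.reCLM.circleAverage_comp_comm hci
    rw [hd.circleAverage] at this
    exact this
  rw [circleAverage_eq_integral] at h1 ⊢
  rw [integral_add (integrable_circleMap hre) (integrable_const C), h1]
  simp

/-- Maximum principle: a function with the sub-mean value property off `T` is dominated by the
real part of a holomorphic function if it is so on `T`. -/
theorem le_re_of_le_re_on {R T : Set ℂ} {f : ℂ → ℝ} {H : ℂ → ℂ} {m : ℝ} (hR : IsCompact R)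
    (hf : UpperSemicontinuousOn f R) (hm : ∀ z ∈ R, m ≤ f z)
    (hH : ∀ z ∈ R, DifferentiableAt ℂ H z)
    (hint : ∀ p ∈ R, p ∉ T → ∃ r > 0, Metric.closedBall p r ⊆ R ∧ f p ≤ Real.circleAverage f p r)
    (hT : ∀ z ∈ R, z ∈ T → f z ≤ (H z).re) : ∀ z ∈ R, f z ≤ (H z).re := by
  intro z hz
  obtain ⟨B, hB⟩ := hR.isBounded.exists_norm_le
  have key : ∀ δ > 0, f z ≤ (H z).re + δ * B ^ 2 := by
    intro δ hδ
    -- The term `δ * ‖z‖ ^ 2` makes the function strictly subharmonic off `T`, so its maximum can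
    -- only be attained on `T`.
    have husc : UpperSemicontinuousOn (fun z => f z + (δ * ‖z‖ ^ 2 - (H z).re)) R := by
      refine hf.add (ContinuousOn.upperSemicontinuousOn ?_)
      refine ContinuousOn.sub (Continuous.continuousOn (by fun_prop)) ?_
      exact Complex.continuous_re.comp_continuousOn fun w hw =>
        (hH w hw).continuousAt.continuousWithinAt
    obtain ⟨p, hp, hmax⟩ := husc.exists_isMaxOn ⟨z, hz⟩ hR
    have hmax' : ∀ w ∈ R, f w + (δ * ‖w‖ ^ 2 - (H w).re) ≤ f p + (δ * ‖p‖ ^ 2 - (H p).re) :=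
      fun w hw => hmax hw
    by_cases hpT : p ∈ T
    · have h1 := hmax' z hz
      have h2 := hT p hp hpT
      have h3 : δ * ‖p‖ ^ 2 ≤ δ * B ^ 2 := by
        have := hB p hp
        gcongr
      have h4 : 0 ≤ δ * ‖z‖ ^ 2 := by positivity
      linarith
    · exfalso
      obtain ⟨r, hr, hball, hle⟩ := hint p hp hpT
      -- On the circle, `‖w‖ ^ 2` equals `‖p‖ ^ 2 + r ^ 2` plus the real part of a holomorphic
      -- function vanishing at `p`. Averaging the maximality bound thus loses exactly `δ * r ^ 2`,
      -- against `hle`.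
      obtain ⟨hci, hav⟩ := circleAverage_re_add_const (p := p)
        (G := fun w => H w - δ * (2 * (starRingEnd ℂ) p * (w - p))) hr
        (fun w hw => (hH w (hball hw)).sub (by fun_prop)) (f p - (H p).re - δ * r ^ 2)
      have hmono := Real.circleAverage_mono (f₁ := f) (c := p) (R := r)
        (circleIntegrable_of_upperSemicontinuousOn
          (hf.mono ((sphere_abs_subset hr).trans hball))
          fun w hw => hm w (hball (sphere_abs_subset hr hw))) hci (by
          intro w hw
          have h1 := hmax' w (hball (sphere_abs_subset hr hw))
          rw [abs_of_pos hr, mem_sphere_iff_norm] at hw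
          have h2 : ‖w‖ ^ 2 = ‖p‖ ^ 2 + r ^ 2 + (2 * (starRingEnd ℂ) p * (w - p)).re := by
            rw [← hw, ← Complex.normSq_eq_norm_sq, ← Complex.normSq_eq_norm_sq,
              ← Complex.normSq_eq_norm_sq, Complex.normSq_apply, Complex.normSq_apply,
              Complex.normSq_apply]
            simp
            ring
          rw [Complex.sub_re, Complex.re_ofReal_mul]
          rw [h2] at h1
          linarith)
      rw [hav] at hmono
      have : 0 < δ * r ^ 2 := by positivity
      simp at hmono
      linarith
  refine le_of_forall_pos_le_add fun ε hε => ?_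
  have h1 := key (ε / (B ^ 2 + 1)) (by positivity)
  have h2 : ε / (B ^ 2 + 1) * B ^ 2 ≤ ε := by
    rw [div_mul_eq_mul_div, div_le_iff₀ (by positivity)]
    nlinarith
  linarith

/-- A rectangle with one vertical side on the imaginary axis. -/
def sideBox (s a τ : ℝ) : Set ℂ := {σ | s * σ.re ∈ Icc 0 a ∧ |σ.im| ≤ τ}

theorem norm_le_of_mem_sideBox {s a τ : ℝ} (hs : |s| = 1) {σ : ℂ} (hσ : σ ∈ sideBox s a τ) :
    ‖σ‖ ≤ a + τ := by
  refine (Complex.norm_le_abs_re_add_abs_im σ).trans (add_le_add ?_ hσ.2)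
  have h1 : |s * σ.re| = |σ.re| := by rw [abs_mul, hs, one_mul]
  rw [← h1, abs_of_nonneg hσ.1.1]
  exact hσ.1.2

theorem isCompact_sideBox {s a τ : ℝ} (hs : |s| = 1) : IsCompact (sideBox s a τ) := by
  refine Metric.isCompact_of_isClosed_isBounded ?_ ?_
  · have h1 : Continuous fun σ : ℂ => s * σ.re := by fun_prop
    have h2 : Continuous fun σ : ℂ => |σ.im| := by fun_prop
    exact (isClosed_Icc.preimage h1).inter (isClosed_le h2 continuous_const)
  · exact (Metric.isBounded_closedBall (x := (0 : ℂ)) (r := a + τ)).subset fun σ hσ => by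
      rw [mem_closedBall_zero_iff]
      exact norm_le_of_mem_sideBox hs hσ

/-- Estimate at a point of the logarithmic box based at `w`, with an explicit majorant. -/
theorem le_of_logBox {f : ℂ → ℝ} {w : ℂ} {s τ m B e K L : ℝ} (hw : w ≠ 0) (hs : |s| = 1)
    (hτ : 0 < τ) (hτ1 : τ < Real.pi / 2) (hK : 0 ≤ K) (hKB : B ≤ K * (τ ^ 2 - (τ / 2) ^ 2))
    (hL : 0 ≤ L) (hLB : B ≤ L * (τ / 2) - K * (τ / 2) ^ 2) (he : 0 ≤ e)
    {D : Set ℂ} (hf : UpperSemicontinuousOn f D)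
    (hD : ∀ σ ∈ sideBox s (τ / 2) τ, w * Complex.exp σ ∈ D)
    (hm : ∀ z ∈ D, m ≤ f z) (hB : ∀ z ∈ D, f z ≤ m + B)
    (hmean : ∀ p r, 0 < r → Metric.closedBall p r ⊆ D → f p ≤ Real.circleAverage f p r)
    (hrot : ∀ θ : ℝ, |θ| ≤ τ → f (w * Complex.exp (θ * Complex.I)) ≤ f w + e)
    {σ : ℂ} (hσ : σ ∈ sideBox s (τ / 2) τ) :
    f (w * Complex.exp σ) ≤ f w + e + K * (σ.im ^ 2 - σ.re ^ 2) + L * (s * σ.re) := by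
  have hlog : ∀ σ ∈ sideBox s (τ / 2) τ, Complex.log (w * Complex.exp σ / w) = σ := by
    intro σ hσ
    have h1 := abs_le.1 hσ.2
    have hpi := Real.pi_pos
    rw [mul_div_cancel_left₀ _ hw, Complex.log_exp (by linarith [h1.1]) (by linarith [h1.2])]
  have hw0 : (0 : ℂ) ∈ sideBox s (τ / 2) τ := by
    constructor
    · simpa using (half_pos hτ).le
    · simpa using hτ.le
  have hwD : w ∈ D := by simpa using hD 0 hw0
  -- The quadratic term beats `B` on the horizontal sides, the linear term on the far vertical side;
  -- on the imaginary axis `f w + e` suffices.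
  let H : ℂ → ℂ := fun z => ((f w + e : ℝ) : ℂ) + (-K * (Complex.log (z / w)) ^ 2 +
    (L * s : ℝ) * Complex.log (z / w))
  have hHre : ∀ σ ∈ sideBox s (τ / 2) τ, (H (w * Complex.exp σ)).re =
      f w + e + K * (σ.im ^ 2 - σ.re ^ 2) + L * (s * σ.re) := by
    intro σ hσ
    simp only [H, hlog σ hσ, Complex.add_re, Complex.ofReal_re, neg_mul, Complex.neg_re,
      pow_two, Complex.mul_re, Complex.ofReal_im]
    ring
  rw [← hHre σ hσ]
  let Q := sideBox s (τ / 2) τ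
  let T : Set ℂ := {z | ∃ σ ∈ Q, z = w * Complex.exp σ ∧
    (s * σ.re = 0 ∨ s * σ.re = τ / 2 ∨ |σ.im| = τ)}
  have hRD : (fun σ => w * Complex.exp σ) '' Q ⊆ D := by
    rintro _ ⟨σ, hσ, rfl⟩
    exact hD σ hσ
  refine le_re_of_le_re_on (T := T) (m := m) (R := (fun σ => w * Complex.exp σ) '' Q)
    ((isCompact_sideBox hs).image (by fun_prop)) (hf.mono hRD) (fun z hz => hm z (hRD hz))
    ?_ ?_ ?_ _ (mem_image_of_mem _ hσ)
  · rintro _ ⟨σ, hσ, rfl⟩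
    have hslit : w * Complex.exp σ / w ∈ Complex.slitPlane := by
      left
      rw [mul_div_cancel_left₀ _ hw, Complex.exp_re]
      have h1 := abs_le.1 hσ.2
      exact mul_pos (Real.exp_pos _) (Real.cos_pos_of_mem_Ioo ⟨by linarith, by linarith⟩)
    have hl : DifferentiableAt ℂ (fun z => Complex.log (z / w)) (w * Complex.exp σ) :=
      DifferentiableAt.clog (by fun_prop) hslit
    exact (differentiableAt_const _).add (((hl.pow 2).const_mul _).add (hl.const_mul _))
  · rintro _ ⟨σ, hσ, rfl⟩ hnT
    have hne : s * σ.re ≠ 0 ∧ s * σ.re ≠ τ / 2 ∧ |σ.im| ≠ τ := by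
      refine ⟨fun h => hnT ⟨σ, hσ, rfl, Or.inl h⟩, fun h => hnT ⟨σ, hσ, rfl, Or.inr (Or.inl h)⟩,
        fun h => hnT ⟨σ, hσ, rfl, Or.inr (Or.inr h)⟩⟩
    let O : Set ℂ := {σ | (0 < s * σ.re ∧ s * σ.re < τ / 2) ∧ |σ.im| < τ}
    have hO : IsOpen O := by
      have h1 : Continuous fun σ : ℂ => s * σ.re := by fun_prop
      have h2 : Continuous fun σ : ℂ => |σ.im| := by fun_prop
      exact ((isOpen_lt continuous_const h1).inter (isOpen_lt h1 continuous_const)).inter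
        (isOpen_lt h2 continuous_const)
    have hOQ : O ⊆ Q := fun σ h => ⟨⟨h.1.1.le, h.1.2.le⟩, h.2.le⟩
    have hσO : σ ∈ O := ⟨⟨lt_of_le_of_ne hσ.1.1 hne.1.symm, lt_of_le_of_ne hσ.1.2 hne.2.1⟩,
      lt_of_le_of_ne hσ.2 hne.2.2⟩
    have himg : IsOpen ((fun σ => w * Complex.exp σ) '' O) := by
      have := (Homeomorph.mulLeft₀ w hw).isOpenMap.comp Complex.isOpenMap_exp
      exact this O hO
    obtain ⟨r, hr, hball⟩ := Metric.nhds_basis_closedBall.mem_iff.1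
      (himg.mem_nhds (mem_image_of_mem _ hσO))
    have hball' := hball.trans (image_mono hOQ)
    exact ⟨r, hr, hball', hmean _ _ hr (hball'.trans hRD)⟩
  · rintro _ - ⟨σ, hσ, rfl, h⟩
    rw [hHre σ hσ]
    have hsq : (s * σ.re) ^ 2 = σ.re ^ 2 := by rw [mul_pow, ← sq_abs s, hs]; ring
    have hub := hB _ (hD σ hσ)
    have hmw := hm w hwD
    have h0 : 0 ≤ s * σ.re := hσ.1.1
    have ha : s * σ.re ≤ τ / 2 := hσ.1.2
    rcases h with h | h | h
    · have hre : σ.re = 0 := by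
        rcases mul_eq_zero.1 h with h | h
        · rw [h] at hs
          simp at hs
        · exact h
      have h1 := hrot σ.im hσ.2
      have h2 : σ = σ.im * Complex.I := by
        apply Complex.ext <;> simp [hre]
      rw [← h2] at h1
      rw [hre]
      nlinarith [mul_nonneg hK (sq_nonneg σ.im)]
    · rw [← hsq, h]
      nlinarith [mul_nonneg hK (sq_nonneg σ.im)]
    · have h1 : σ.im ^ 2 = τ ^ 2 := by rw [← sq_abs, h]
      have h2 : σ.re ^ 2 ≤ (τ / 2) ^ 2 := by
        rw [← hsq]
        exact pow_le_pow_left₀ h0 ha 2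
      rw [h1]
      nlinarith [mul_nonneg hL h0, mul_le_mul_of_nonneg_left h2 hK]

/-- Lower semicontinuity at a point `c ≠ 0` for subharmonic functions with an angular modulus of
continuity, uniform in the function. -/
theorem exists_forall_le_add_of_ne_zero {c : ℂ} (hc : c ≠ 0) {ρ B τ₀ ε : ℝ} (hρ : 0 < ρ)
    (hB : 0 ≤ B) (hτ₀ : 0 < τ₀) (hε : 0 < ε) :
    ∃ η > 0, η ≤ ρ ∧ ∀ (f : ℂ → ℝ) (m : ℝ), UpperSemicontinuousOn f (Metric.closedBall c ρ) →
      (∀ z ∈ Metric.closedBall c ρ, m ≤ f z) → (∀ z ∈ Metric.closedBall c ρ, f z ≤ m + B) →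
      (∀ p r, 0 < r → Metric.closedBall p r ⊆ Metric.closedBall c ρ →
        f p ≤ Real.circleAverage f p r) →
      (∀ θ : ℝ, |θ| ≤ τ₀ → ∀ z ∈ Metric.closedBall c ρ,
        z * Complex.exp (θ * Complex.I) ∈ Metric.closedBall c ρ →
        f (z * Complex.exp (θ * Complex.I)) ≤ f z + ε / 2) →
      ∀ w ∈ Metric.ball c η, f c ≤ f w + ε := by
  have hcont : Tendsto (fun x : ℂ × ℂ => x.1 * Complex.exp x.2) (𝓝 (c, 0)) (𝓝 c) := by
    have : Continuous fun x : ℂ × ℂ => x.1 * Complex.exp x.2 := by fun_prop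
    simpa using this.tendsto (c, 0)
  obtain ⟨δ, hδ, hδball⟩ := Metric.eventually_nhds_iff_ball.1
    (hcont.eventually (Metric.closedBall_mem_nhds c hρ))
  obtain ⟨τ, hτ, hτlt⟩ : ∃ τ > 0, τ < min (min τ₀ (δ / 2)) (Real.pi / 2) := by
    refine exists_between ?_
    have := Real.pi_pos
    positivity
  have hττ₀ : τ < τ₀ := hτlt.trans_le ((min_le_left _ _).trans (min_le_left _ _))
  have hτδ : τ < δ / 2 := hτlt.trans_le ((min_le_left _ _).trans (min_le_right _ _))
  have hτpi : τ < Real.pi / 2 := hτlt.trans_le (min_le_right _ _)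
  -- `K` gives `3 / 2 * B` on the horizontal sides; `L` compensates the negative quadratic term on
  -- the far side.
  set K := 2 * B / τ ^ 2 with hKdef
  set L := (B + K * (τ / 2) ^ 2) / (τ / 2) with hLdef
  have hK : 0 ≤ K := by positivity
  have hL : 0 ≤ L := by positivity
  have hKB : B ≤ K * (τ ^ 2 - (τ / 2) ^ 2) := by
    have : K * (τ ^ 2 - (τ / 2) ^ 2) = 3 / 2 * B := by
      rw [hKdef]
      field_simp
      ring
    rw [this]
    linarith
  have hLB : B ≤ L * (τ / 2) - K * (τ / 2) ^ 2 := by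
    rw [hLdef, div_mul_cancel₀ _ (by positivity)]
    linarith
  have hlogt : Tendsto (fun w : ℂ => Complex.log (c / w)) (𝓝 c) (𝓝 0) := by
    have h1 : ContinuousAt (fun w : ℂ => Complex.log (c / w)) c := by
      refine ContinuousAt.clog (continuousAt_const.div continuousAt_id hc) ?_
      simp [hc]
    simpa [ContinuousAt, hc] using h1
  have hsmall : Tendsto (fun σ : ℂ => K * σ.im ^ 2 + L * |σ.re|) (𝓝 0) (𝓝 0) := by
    have : Continuous fun σ : ℂ => K * σ.im ^ 2 + L * |σ.re| := by fun_prop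
    simpa using this.tendsto 0
  have hev : ∀ᶠ w in 𝓝 c, w ≠ 0 ∧ ‖Complex.log (c / w)‖ < τ / 2 ∧
      K * (Complex.log (c / w)).im ^ 2 + L * |(Complex.log (c / w)).re| < ε / 2 := by
    refine (eventually_ne_nhds hc).and (Eventually.and ?_ ?_)
    · have := hlogt.norm
      rw [norm_zero] at this
      exact this.eventually (gt_mem_nhds (half_pos hτ))
    · exact (hsmall.comp hlogt).eventually (gt_mem_nhds (half_pos hε))
  obtain ⟨η, hη, hηball⟩ := Metric.eventually_nhds_iff_ball.1 hev
  refine ⟨min η (min ρ δ), by positivity, (min_le_right _ _).trans (min_le_left _ _),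
    fun f m hf hm hfB hmean hrot w hw => ?_⟩
  have hwδ : dist w c < δ :=
    (Metric.mem_ball.1 hw).trans_le ((min_le_right _ _).trans (min_le_right _ _))
  obtain ⟨hw0, hlog, hsm⟩ := hηball w (Metric.ball_subset_ball (min_le_left _ _) hw)
  have hD : ∀ σ : ℂ, ‖σ‖ < δ → w * Complex.exp σ ∈ Metric.closedBall c ρ := by
    intro σ hσ
    refine hδball (w, σ) ?_
    rw [Metric.mem_ball, Prod.dist_eq, max_lt_iff]
    exact ⟨hwδ, by simpa using hσ⟩
  have hwD : w ∈ Metric.closedBall c ρ := by simpa using hD 0 (by simpa using hδ)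
  set σ := Complex.log (c / w) with hσdef
  have hσc : w * Complex.exp σ = c := by
    rw [hσdef, Complex.exp_log (div_ne_zero hc hw0), mul_div_cancel₀ _ hw0]
  have hre : |σ.re| ≤ τ / 2 := (Complex.abs_re_le_norm σ).trans hlog.le
  have him : |σ.im| ≤ τ := ((Complex.abs_im_le_norm σ).trans hlog.le).trans (by linarith)
  -- The sign puts the box based at `w` on the side where `c` lies.
  obtain ⟨s, hs, hsre⟩ : ∃ s : ℝ, |s| = 1 ∧ s * σ.re = |σ.re| := by
    rcases le_total 0 σ.re with h | h
    · exact ⟨1, by simp, by rw [abs_of_nonneg h, one_mul]⟩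
    · exact ⟨-1, by simp, by rw [abs_of_nonpos h]; ring⟩
  have hσbox : σ ∈ sideBox s (τ / 2) τ := ⟨by rw [hsre]; exact ⟨abs_nonneg _, hre⟩, him⟩
  have key := le_of_logBox (e := ε / 2) hw0 hs hτ hτpi hK hKB hL hLB (half_pos hε).le hf
    (fun σ' hσ' => hD σ' (by linarith [norm_le_of_mem_sideBox hs hσ'])) hm hfB hmean
    (fun θ hθ => hrot θ (hθ.trans hττ₀.le) w hwD (hD _ (by
      rw [norm_mul, Complex.norm_I, mul_one, Complex.norm_real, Real.norm_eq_abs]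
      linarith))) hσbox
  rw [hσc, hsre] at key
  nlinarith [mul_nonneg hK (sq_nonneg σ.re)]

/-! ### Lower semicontinuity from the angular modulus. -/

/-- One-sided toric modulus of continuity in terms of angles. -/
def HasAngularModulus {n : ℕ} (v : (Fin n → ℂ) → ℝ) (Ω : Set (Fin n → ℂ)) : Prop :=
  ∀ ε > 0, ∃ τ > 0, ∀ θ : Fin n → ℝ, (∀ j, |θ j| ≤ τ) → ∀ z ∈ Ω,
    v (rotate (fun j => Circle.exp (θ j)) z) ≤ v z + ε

theorem angleMeasure_real_Ioc_pos {τ : ℝ} (hτ : 0 < τ) : 0 < angleMeasure.real (Ioc 0 τ) := by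
  refine ENNReal.toReal_pos ?_ (measure_ne_top _ _)
  rw [angleMeasure_eq, Measure.smul_apply, Measure.restrict_apply measurableSet_Ioc,
    Ioc_inter_Ioc, Real.volume_Ioc, smul_eq_mul]
  refine mul_ne_zero ?_ ?_
  · rw [Ne, ENNReal.ofReal_eq_zero, not_le]
    have := Real.pi_pos
    positivity
  · rw [Ne, ENNReal.ofReal_eq_zero, not_le, max_self, sub_zero]
    exact lt_min hτ Real.two_pi_pos

section LowerSemicontinuity

variable {n : ℕ} {Ω : Set (Fin n → ℂ)} {v : (Fin n → ℂ) → ℝ}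

theorem exists_closedBall_subset_and_lt (hΩ : IsOpen Ω) (hv : UpperSemicontinuousOn v Ω)
    {z₀ : Fin n → ℂ} (hz₀ : z₀ ∈ Ω) {δ : ℝ} (hδ : 0 < δ) :
    ∃ ρ > 0, ∀ z ∈ Metric.closedBall z₀ ρ, z ∈ Ω ∧ v z < v z₀ + δ := by
  have h1 := hv z₀ hz₀ _ (lt_add_of_pos_right _ hδ)
  rw [hΩ.nhdsWithin_eq hz₀] at h1
  exact Metric.nhds_basis_closedBall.eventually_iff.1 ((hΩ.eventually_mem hz₀).and h1)

theorem piecewise_mem_closedBall {z₀ w : Fin n → ℂ} {ρ : ℝ} (hw : w ∈ Metric.closedBall z₀ ρ)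
    (S : Finset (Fin n)) : S.piecewise w z₀ ∈ Metric.closedBall z₀ ρ := by
  have hρ : 0 ≤ ρ := dist_nonneg.trans hw
  refine (dist_pi_le_iff hρ).2 fun j => ?_
  by_cases hj : j ∈ S
  · simpa [hj] using (dist_pi_le_iff hρ).1 hw j
  · simpa [hj] using hρ

theorem update_eq_add_smul (y : Fin n → ℂ) (k : Fin n) (ζ : ℂ) :
    Function.update y k ζ = Function.update y k 0 + ζ • Pi.single k (1 : ℂ) := by
  ext j
  rcases eq_or_ne j k with rfl | hj
  · simp
  · simp [hj]

/-- Lower semicontinuity in the directions of the nonzero coordinates. -/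
theorem exists_forall_le_piecewise_add (hΩ : IsOpen Ω) (hv : IsRealPsh v Ω) {m : ℝ}
    (hm : ∀ z ∈ Ω, m ≤ v z) (hrot : HasAngularModulus v Ω) {z₀ : Fin n → ℂ} (hz₀ : z₀ ∈ Ω)
    (S : Finset (Fin n)) (hS : ∀ j ∈ S, z₀ j ≠ 0) :
    ∀ ε > 0, ∃ η > 0, ∀ w ∈ Metric.ball z₀ η, v z₀ ≤ v (S.piecewise w z₀) + ε := by
  obtain ⟨ρ, hρ, hball⟩ := exists_closedBall_subset_and_lt hΩ hv.usc hz₀ one_pos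
  induction S using Finset.induction_on with
  | empty =>
    intro ε hε
    exact ⟨1, one_pos, fun w _ => by simpa using hε.le⟩
  | insert k S hk ih =>
    intro ε hε
    obtain ⟨η₁, hη₁, h1⟩ := ih (fun j hj => hS j (Finset.mem_insert_of_mem hj)) (ε / 2)
      (half_pos hε)
    obtain ⟨τ, hτ, hτrot⟩ := hrot (ε / 2 / 2) (by positivity)
    have hB : 0 ≤ v z₀ + 1 - m := by linarith [hm z₀ hz₀]
    -- The radius must not depend on the slice, since the slice through `y` varies with `w`.
    obtain ⟨η₂, hη₂, hη₂ρ, h2⟩ := exists_forall_le_add_of_ne_zero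
      (hS k (Finset.mem_insert_self k S)) hρ hB hτ (half_pos hε)
    refine ⟨min η₁ η₂, lt_min hη₁ hη₂, fun w hw => ?_⟩
    have hw1 := h1 w (Metric.ball_subset_ball (min_le_left _ _) hw)
    have hw2 := Metric.ball_subset_ball (min_le_right _ _) hw
    set y := S.piecewise w z₀ with hy
    have hyk : y k = z₀ k := by simp [hy, hk]
    have hyball : y ∈ Metric.closedBall z₀ ρ := piecewise_mem_closedBall
      (Metric.ball_subset_closedBall (Metric.ball_subset_ball hη₂ρ hw2)) S
    have hupd : ∀ ζ ∈ Metric.closedBall (z₀ k) ρ,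
        Function.update y k ζ ∈ Metric.closedBall z₀ ρ := by
      intro ζ hζ
      refine (dist_pi_le_iff hρ.le).2 fun j => ?_
      rcases eq_or_ne j k with rfl | hj
      · simpa using hζ
      · simpa [hj] using (dist_pi_le_iff hρ.le).1 hyball j
    have hlineΩ : ∀ ζ ∈ Metric.closedBall (z₀ k) ρ,
        Function.update y k 0 + ζ • Pi.single k (1 : ℂ) ∈ Ω := fun ζ hζ => by
      rw [← update_eq_add_smul]
      exact (hball _ (hupd ζ hζ)).1
    have key := h2 (fun ζ => v (Function.update y k ζ)) m
      (by
        have h3 := upperSemicontinuousOn_line hv.usc _ _ hlineΩ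
        simpa only [← update_eq_add_smul] using h3)
      (fun ζ hζ => hm _ (hball _ (hupd ζ hζ)).1)
      (fun ζ hζ => by linarith [(hball _ (hupd ζ hζ)).2])
      (fun p r hr hsub => by
        have h3 := hv.le_circleAverage _ _ p r hr fun ζ hζ => hlineΩ ζ (hsub hζ)
        simpa only [← update_eq_add_smul] using h3)
      (fun θ hθ ζ hζ _ => by
        have h3 := hτrot (Pi.single k θ) (fun j => by
          rcases eq_or_ne j k with rfl | hj
          · simpa using hθ
          · simpa [hj] using hτ.le) _ (hball _ (hupd ζ hζ)).1
        convert h3 using 2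
        ext j
        rcases eq_or_ne j k with rfl | hj
        · simp [rotate, mul_comm]
        · simp [rotate, hj])
      (w k) (by
        have := (dist_pi_lt_iff hη₂).1 hw2 k
        exact this)
    rw [← hyk, Function.update_eq_self] at key
    rw [Finset.piecewise_insert]
    linarith

/-- The point `y` takes the coordinates of `w` where `z₀` is nonzero and vanishes elsewhere, so `v
y` is nearly at least `v z₀`. It is the centre of a disc with `w` on its boundary. -/
theorem IsRealPsh.lowerSemicontinuousOn (hΩ : IsOpen Ω) (hv : IsRealPsh v Ω) {m : ℝ}
    (hm : ∀ z ∈ Ω, m ≤ v z) (hrot : HasAngularModulus v Ω) : LowerSemicontinuousOn v Ω := by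
  intro z₀ hz₀ c hc
  rw [hΩ.nhdsWithin_eq hz₀]
  set ε := v z₀ - c with hεdef
  have hε : 0 < ε := sub_pos.2 hc
  obtain ⟨τ, hτ, hτrot⟩ := hrot (ε / 2) (half_pos hε)
  set q := angleMeasure.real (Ioc 0 τ) with hq
  have hqpos : 0 < q := angleMeasure_real_Ioc_pos hτ
  -- The arc of measure `q` lowers the average by `q * (ε / 2) = 4 * δ`, more than the two errors
  -- `δ` from upper semicontinuity and from replacing `z₀` by `y`.
  set δ := ε * q / 8 with hδdef
  have hδ : 0 < δ := by positivity
  obtain ⟨ρ, hρ, hball⟩ := exists_closedBall_subset_and_lt hΩ hv.usc hz₀ hδ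
  let S : Finset (Fin n) := Finset.univ.filter fun j => z₀ j ≠ 0
  obtain ⟨η, hη, h1⟩ := exists_forall_le_piecewise_add hΩ hv hm hrot hz₀ S
    (fun j hj => (Finset.mem_filter.1 hj).2) δ hδ
  filter_upwards [Metric.ball_mem_nhds z₀ (lt_min hη hρ)] with w hw
  by_contra! hcon
  have hw1 := h1 w (Metric.ball_subset_ball (min_le_left _ _) hw)
  have hwρ : w ∈ Metric.closedBall z₀ ρ := Metric.ball_subset_closedBall
    (Metric.ball_subset_ball (min_le_right _ _) hw)
  set y := S.piecewise w z₀ with hy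
  have hline : ∀ ζ ∈ Metric.closedBall (0 : ℂ) 1,
      y + ζ • (w - y) ∈ Metric.closedBall z₀ ρ := by
    intro ζ hζ
    rw [mem_closedBall_zero_iff] at hζ
    refine (dist_pi_le_iff hρ.le).2 fun j => ?_
    have h2 := (dist_pi_le_iff hρ.le).1 hwρ j
    by_cases hj : j ∈ S
    · simpa [hy, hj] using h2
    · have hz : z₀ j = 0 := by simpa [S] using hj
      rw [hz, dist_zero_right] at h2
      simp only [hy, Pi.add_apply, Pi.smul_apply, Pi.sub_apply, hj, not_false_eq_true,
        Finset.piecewise_eq_of_notMem, hz, dist_zero_right, smul_eq_mul, zero_add, sub_zero,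
        norm_mul]
      exact (mul_le_of_le_one_left (norm_nonneg _) hζ).trans h2
  have h2 := hv.le_circleAverage y (w - y) 0 1 one_pos fun ζ hζ => (hball _ (hline ζ hζ)).1
  rw [zero_smul, add_zero, circleAverage_eq_integral] at h2
  have hcirc : ∀ θ, circleMap 0 1 θ ∈ Metric.closedBall (0 : ℂ) 1 := fun θ =>
    circleMap_mem_closedBall 0 zero_le_one θ
  have hi : Integrable (fun θ => v (y + circleMap 0 1 θ • (w - y))) angleMeasure :=
    integrable_circleMap (circleIntegrable_line hv.usc hm
      fun ζ hζ => (hball _ (hline ζ (sphere_abs_subset one_pos hζ))).1)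
  have hwΩ := (hball w hwρ).1
  have hind : Integrable ((Ioc 0 τ).indicator fun _ : ℝ => ε / 2) angleMeasure :=
    (integrable_const _).indicator measurableSet_Ioc
  have h3 : ∫ θ, v (y + circleMap 0 1 θ • (w - y)) ∂angleMeasure ≤
      ∫ θ, ((v z₀ + δ) - (Ioc 0 τ).indicator (fun _ : ℝ => ε / 2) θ) ∂angleMeasure := by
    refine integral_mono hi ((integrable_const _).sub hind) fun θ => ?_
    by_cases hθ : θ ∈ Ioc 0 τ
    · have h4 := hτrot (fun j => if j ∈ S then 0 else θ) (fun j => by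
        split_ifs
        · simpa using hτ.le
        · rw [abs_of_pos hθ.1]
          exact hθ.2) w hwΩ
      have h5 : rotate (fun j => Circle.exp (if j ∈ S then 0 else θ)) w =
          y + circleMap 0 1 θ • (w - y) := by
        ext j
        by_cases hj : j ∈ S
        · simp [rotate, hy, hj]
        · have hz : z₀ j = 0 := by simpa [S] using hj
          simp [rotate, hy, hj, hz, circleMap]
      rw [h5] at h4
      simp only [indicator_of_mem hθ]
      linarith
    · simp only [indicator_of_notMem hθ, sub_zero]
      exact (hball _ (hline _ (hcirc θ))).2.le
  rw [integral_sub (integrable_const _) hind, integral_indicator measurableSet_Ioc,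
    setIntegral_const, ← hq] at h3
  simp at h3
  have h6 : q * (ε / 2) = 4 * δ := by rw [hδdef]; ring
  linarith

end LowerSemicontinuity

end PerronBremermann

theorem theorem3p1 (n : ℕ) (Ω : Set (Fin n → ℂ)) (hΩ : PerronBremermann.IsReinhardtDomain Ω)
    (F : (Fin n → ℂ) → ℝ) (hF_usc : UpperSemicontinuousOn F Ω)
    (hF_toric : PerronBremermann.ToricallyUniformlyContinuousOn F Ω)
    (hF_bdd : BddBelow (F '' Ω)) :
    (∀ z ∈ Ω, PerronBremermann.envelope Ω F z ≠ ⊥ ∧ PerronBremermann.envelope Ω F z ≠ ⊤) ∧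
      ContinuousOn (PerronBremermann.envelope Ω F) Ω := by
  open PerronBremermann in
  obtain ⟨m, hm⟩ := hF_bdd
  obtain ⟨v, hv, hmv, hvF, hE⟩ := exists_isRealPsh_eq_envelope hΩ.isOpen hF_usc
    fun z hz => hm (mem_image_of_mem F hz)
  have hmod : HasAngularModulus v Ω := by
    intro ε hε
    obtain ⟨τ, hτ, h⟩ := exists_angle_rotate_le hε hF_toric
    exact ⟨τ, hτ, fun θ hθ z hz => rotate_le_add hF_usc hv hmv hvF hE
      (fun w hw => hΩ.rotate_mem _ w hw) (h θ hθ) hz⟩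
  have hcont : ContinuousOn v Ω := continuousOn_iff_lower_upperSemicontinuousOn.2
    ⟨hv.lowerSemicontinuousOn hΩ.isOpen hmv hmod, hv.usc⟩
  refine ⟨fun z hz => ?_, ?_⟩
  · rw [hE z hz]
    exact ⟨EReal.coe_ne_bot _, EReal.coe_ne_top _⟩
  · exact (continuous_coe_real_ereal.comp_continuousOn hcont).congr hE
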